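/- Let $m,n\ge 1$ and $k=\min(m,n)$. Let $\mathcal N_{m,n}$ be the set of multivariate normal laws $P_{XY}$ on $\mathbb R^m\times\mathbb R^n$ for which $P_{XY}$ and its marginals $P_X,P_Y$ have smooth, everywhere positive densities $p_{XY},p_X,p_Y$ with respect to Lebesgue measure. Write $$\mathrm{PMI}_{XY}(x,y)=\log\frac{p_{XY}(x,y)}{p_X(x)\,p_Y(y)}$$ for the pointwise mutual information, let the PMI profile $\mathrm{Prof}_{XY}$ be the distribution of $\mathrm{PMI}_{XY}(X,Y)$ for $(X,Y)\sim P_{XY}$, let $\mathbf I(X;Y)=D_{\mathrm{KL}}(P_{XY}\,\|\,P_X\otimes P_Y)$ be the mutual information (in nats), and let $\rho_1,\dots,\rho_k$ be the canonical correlations between $X$ and $Y$, i.e. the $k$ largest singular values (counted with multiplicity, zeros included) of $\Sigma_X^{-1/2}\Sigma_{XY}\Sigma_Y^{-1/2}$, where $\Sigma_X,\Sigma_Y$ are the covariance matrices and $\Sigma_{XY}$ is the cross-covariance matrix. For every $P_{XY}\in\mathcal N_{m,n}$ the mutual information is finite, the PMI profile has a finite second moment, and $$\operatorname{Var}(\mathrm{Prof}_{XY})\le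 k\left(1-\exp\left(-\frac{2\,\mathbf I(X;Y)}{k}\right)\right).$$ Moreover, for every fixed value $I\ge 0$, a law $P_{XY}\in\mathcal N_{m,n}$ with $\mathbf I(X;Y)=I$ maximizes the variance of the PMI profile among all laws in $\mathcal N_{m,n}$ with mutual information $I$ if and only if $\rho_1^2=\rho_2^2=\dots=\rho_k^2$; and the maximum is attained and equals $V=k\left(1-\exp(-2I/k)\right)$. -/

import Mathlib

open MeasureTheory ProbabilityTheory
open scoped ENNReal NNReal ContDiff MatrixOrder

noncomputable section

namespace PMIProfile

/-- `μ` has a smooth, everywhere positive probability density with respect to the reference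
(Lebesgue) measure. -/
def HasSmoothPosDensity {E : Type*} [NormedAddCommGroup E] [NormedSpace ℝ E] [MeasureSpace E]
    (μ : Measure E) : Prop :=
  ∃ p : E → ℝ, ContDiff ℝ ∞ p ∧ (∀ x, 0 < p x) ∧
    μ = volume.withDensity (fun x => ENNReal.ofReal (p x))

/-- The class `𝒫(ℝᵐ, ℝⁿ)`: joint laws of pairs `(X, Y)` such that the joint law and both marginals
have smooth positive densities. -/
def IsNice {m n : ℕ} (P : Measure (EuclideanSpace ℝ (Fin m) × EuclideanSpace ℝ (Fin n))) : Prop :=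
  IsProbabilityMeasure P ∧ HasSmoothPosDensity P ∧
    HasSmoothPosDensity P.fst ∧ HasSmoothPosDensity P.snd

/-- The joint law of `(X, Y)` is multivariate normal and belongs to the class `𝒫(ℝᵐ, ℝⁿ)`. -/
def IsNiceNormal {m n : ℕ}
    (P : Measure (EuclideanSpace ℝ (Fin m) × EuclideanSpace ℝ (Fin n))) : Prop :=
  IsGaussian P ∧ IsNice P

/-- Pointwise mutual information `log (p_XY (x, y) / (p_X x * p_Y y))`, the three densities being
those with respect to Lebesgue measure. They are determined up to null sets; the choice of
versions does not affect the profile below. -/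
def pmi {m n : ℕ} (P : Measure (EuclideanSpace ℝ (Fin m) × EuclideanSpace ℝ (Fin n)))
    (z : EuclideanSpace ℝ (Fin m) × EuclideanSpace ℝ (Fin n)) : ℝ :=
  Real.log ((P.rnDeriv volume z).toReal /
    ((P.fst.rnDeriv volume z.1).toReal * (P.snd.rnDeriv volume z.2).toReal))

lemma measurable_pmi {m n : ℕ}
    (P : Measure (EuclideanSpace ℝ (Fin m) × EuclideanSpace ℝ (Fin n))) : Measurable (pmi P) := by
  have h1 : Measurable fun z => (P.rnDeriv volume z).toReal :=
    (Measure.measurable_rnDeriv P volume).ennreal_toReal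
  have h2 : Measurable fun x => (P.fst.rnDeriv volume x).toReal :=
    (Measure.measurable_rnDeriv P.fst volume).ennreal_toReal
  have h3 : Measurable fun y => (P.snd.rnDeriv volume y).toReal :=
    (Measure.measurable_rnDeriv P.snd volume).ennreal_toReal
  exact Real.measurable_log.comp
    (h1.div ((h2.comp measurable_fst).mul (h3.comp measurable_snd)))

/-- The PMI profile: the distribution of `PMI_XY (X, Y)` for `(X, Y)` with law `P`. -/
def profile {m n : ℕ} (P : Measure (EuclideanSpace ℝ (Fin m) × EuclideanSpace ℝ (Fin n))) :
    Measure ℝ :=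
  P.map (pmi P)

/-- The variance of the PMI profile. -/
def profileVariance {m n : ℕ}
    (P : Measure (EuclideanSpace ℝ (Fin m) × EuclideanSpace ℝ (Fin n))) : ℝ :=
  Var[id; profile P]

/-- Mutual information (in nats): the Kullback-Leibler divergence of the joint law from the product
of the marginals. -/
def mutualInfo {m n : ℕ} (P : Measure (EuclideanSpace ℝ (Fin m) × EuclideanSpace ℝ (Fin n))) :
    ℝ≥0∞ :=
  InformationTheory.klDiv P (P.fst.prod P.snd)

/-- The covariance matrix of `X`. -/
def covX {m n : ℕ} (P : Measure (EuclideanSpace ℝ (Fin m) × EuclideanSpace ℝ (Fin n))) :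
    Matrix (Fin m) (Fin m) ℝ :=
  Matrix.of fun i j => cov[fun z => z.1 i, fun z => z.1 j; P]

/-- The covariance matrix of `Y`. -/
def covY {m n : ℕ} (P : Measure (EuclideanSpace ℝ (Fin m) × EuclideanSpace ℝ (Fin n))) :
    Matrix (Fin n) (Fin n) ℝ :=
  Matrix.of fun i j => cov[fun z => z.2 i, fun z => z.2 j; P]

/-- The cross-covariance matrix of `X` and `Y`. -/
def covXY {m n : ℕ} (P : Measure (EuclideanSpace ℝ (Fin m) × EuclideanSpace ℝ (Fin n))) :
    Matrix (Fin m) (Fin n) ℝ :=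
  Matrix.of fun i j => cov[fun z => z.1 i, fun z => z.2 j; P]

/-- The cross-covariance matrix `Σ_X ^ (-1/2) Σ_XY Σ_Y ^ (-1/2)` of the whitened variables. -/
def whitenedCov {m n : ℕ} (P : Measure (EuclideanSpace ℝ (Fin m) × EuclideanSpace ℝ (Fin n))) :
    Matrix (Fin m) (Fin n) ℝ :=
  CFC.sqrt (covX P)⁻¹ * covXY P * CFC.sqrt (covY P)⁻¹

/-- The canonical correlations `ρ₁ ≥ ρ₂ ≥ … ≥ ρ_k ≥ 0`, `k = min (m, n)`, between `X` and `Y`: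
the singular values of the whitened cross-covariance matrix, regarded as a map `ℝⁿ → ℝᵐ`. -/
def canonicalCorr {m n : ℕ} (P : Measure (EuclideanSpace ℝ (Fin m) × EuclideanSpace ℝ (Fin n)))
    (i : Fin (min m n)) : ℝ :=
  (Matrix.toLpLin 2 2 (whitenedCov P)).singularValues i

end PMIProfile

end

theorem integral_pow_four_gaussianReal (v : ℝ≥0) :
    ∫ x, x ^ 4 ∂(gaussianReal 0 v) = 3 * (v : ℝ) ^ 2 := by
  have h := iteratedDeriv_mgf_zero (X := id) (μ := gaussianReal 0 v) (by simp) 4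
  have h' : ∫ x, (id ^ 4 : ℝ → ℝ) x ∂(gaussianReal 0 v) = ∫ x, x ^ 4 ∂(gaussianReal 0 v) := rfl
  rw [← h', ← h, mgf_id_gaussianReal]
  have key : ∀ (a b c d e : ℝ), deriv (fun t : ℝ ↦ (a + b * t + c * t ^ 2 + d * t ^ 3 + e * t ^ 4) *
      Real.exp (0 * t + v * t ^ 2 / 2)) = fun t ↦ ((b + 2 * c * t + 3 * d * t ^ 2 + 4 * e * t ^ 3) +
        v * t * (a + b * t + c * t ^ 2 + d * t ^ 3 + e * t ^ 4)) *
        Real.exp (0 * t + v * t ^ 2 / 2) := by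
    intro a b c d e
    funext t
    have h1 : HasDerivAt (fun t : ℝ ↦ Real.exp (0 * t + v * t ^ 2 / 2))
        (Real.exp (0 * t + v * t ^ 2 / 2) * (0 * 1 + v * (2 * t) / 2)) t := by
      apply HasDerivAt.exp
      refine ((hasDerivAt_id t).const_mul 0).add ?_
      refine HasDerivAt.div_const (HasDerivAt.const_mul _ ?_) _
      simpa using hasDerivAt_pow 2 t
    have h2 : HasDerivAt (fun t : ℝ ↦ a + b * t + c * t ^ 2 + d * t ^ 3 + e * t ^ 4)
        (0 + b * 1 + c * (2 * t) + d * (3 * t ^ 2) + e * (4 * t ^ 3)) t := by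
      refine (((((hasDerivAt_const t a).add ((hasDerivAt_id t).const_mul b))).add
        (HasDerivAt.const_mul c ?_)).add (HasDerivAt.const_mul d ?_)).add (HasDerivAt.const_mul e ?_)
      · simpa using hasDerivAt_pow 2 t
      · simpa using hasDerivAt_pow 3 t
      · simpa using hasDerivAt_pow 4 t
    refine (h2.mul h1).deriv.trans ?_
    ring
  have e0 : (fun t : ℝ ↦ Real.exp (0 * t + v * t ^ 2 / 2)) = fun t ↦
      (1 + 0 * t + 0 * t ^ 2 + 0 * t ^ 3 + 0 * t ^ 4) * Real.exp (0 * t + v * t ^ 2 / 2) := by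
    funext t; ring
  have e1 : deriv (fun t : ℝ ↦ Real.exp (0 * t + v * t ^ 2 / 2)) = fun t ↦
      (0 + v * t + 0 * t ^ 2 + 0 * t ^ 3 + 0 * t ^ 4) * Real.exp (0 * t + v * t ^ 2 / 2) := by
    rw [e0, key]; funext t; ring
  have e2 : deriv (deriv (fun t : ℝ ↦ Real.exp (0 * t + v * t ^ 2 / 2))) = fun t ↦
      (v + 0 * t + v ^ 2 * t ^ 2 + 0 * t ^ 3 + 0 * t ^ 4) * Real.exp (0 * t + v * t ^ 2 / 2) := by
    rw [e1, key]; funext t; ring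
  have e3 : deriv (deriv (deriv (fun t : ℝ ↦ Real.exp (0 * t + v * t ^ 2 / 2)))) = fun t ↦
      (0 + 3 * v ^ 2 * t + 0 * t ^ 2 + v ^ 3 * t ^ 3 + 0 * t ^ 4) *
        Real.exp (0 * t + v * t ^ 2 / 2) := by
    rw [e2, key]; funext t; ring
  simp only [iteratedDeriv_succ, iteratedDeriv_zero]
  rw [e3, key]
  simp

theorem integral_sq_gaussianReal (v : ℝ≥0) : ∫ x, x ^ 2 ∂(gaussianReal 0 v) = v := by
  have h := variance_id_gaussianReal (μ := 0) (v := v)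
  rw [variance_eq_integral measurable_id.aemeasurable] at h
  simpa using h

theorem memLp_sq_gaussianReal (v : ℝ≥0) : MemLp (fun x : ℝ ↦ x ^ 2) 2 (gaussianReal 0 v) := by
  have h := memLp_id_gaussianReal' (μ := 0) (v := v) 4 (by simp)
  rw [memLp_two_iff_integrable_sq (by fun_prop)]
  have := h.integrable_norm_pow (p := 4) (by norm_num)
  refine this.congr (.of_forall fun x ↦ ?_)
  simp only [id, Real.norm_eq_abs]
  rw [← pow_mul, show 2 * 2 = 4 from rfl, Even.pow_abs (by decide)]

theorem variance_sq_gaussianReal (v : ℝ≥0) :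
    Var[fun x ↦ x ^ 2; gaussianReal 0 v] = 2 * (v : ℝ) ^ 2 := by
  rw [variance_eq_sub (memLp_sq_gaussianReal v)]
  have : ∫ x, ((fun x : ℝ ↦ x ^ 2) ^ 2) x ∂(gaussianReal 0 v) = 3 * (v : ℝ) ^ 2 := by
    rw [← integral_pow_four_gaussianReal]
    refine integral_congr_ae (.of_forall fun x ↦ ?_)
    simp only [Pi.pow_apply]; ring
  rw [this, integral_sq_gaussianReal]
  ring

theorem lintegral_fin_nat_prod_eq_prod {n : ℕ} {E : Fin n → Type*}
    {mE : ∀ i, MeasurableSpace (E i)} {μ : ∀ i, Measure (E i)} [∀ i, SigmaFinite (μ i)]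
    {f : ∀ i, E i → ℝ≥0∞} (hf : ∀ i, Measurable (f i)) :
    ∫⁻ x, ∏ i, f i (x i) ∂(Measure.pi μ) = ∏ i, ∫⁻ x, f i x ∂(μ i) := by
  induction n with
  | zero => simp
  | succ n n_ih =>
      calc
        _ = ∫⁻ x : E 0 × ((i : Fin n) → E (Fin.succ i)),
            f 0 x.1 * ∏ i : Fin n, f (Fin.succ i) (x.2 i)
            ∂((μ 0).prod (Measure.pi (fun i ↦ μ i.succ))) := by
          rw [← ((measurePreserving_piFinSuccAbove μ 0).symm).lintegral_comp_emb
            (MeasurableEquiv.measurableEmbedding _)]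
          refine lintegral_congr fun x ↦ ?_
          rw [Fin.prod_univ_succ]
          rfl
        _ = (∫⁻ x, f 0 x ∂μ 0)
            * ∏ i : Fin n, ∫⁻ (x : E (Fin.succ i)), f (Fin.succ i) x ∂(μ i.succ) := by
          rw [← n_ih fun i ↦ hf _, ← lintegral_prod_mul]
          · exact (hf 0).aemeasurable
          · exact (Finset.measurable_prod _
              fun i _ ↦ (hf _).comp (measurable_pi_apply i)).aemeasurable
        _ = ∏ i, ∫⁻ x, f i x ∂(μ i) := by rw [Fin.prod_univ_succ]

/-- Tonelli's theorem for a product of functions of one variable each. -/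
theorem lintegral_fintype_prod_eq_prod {ι : Type*} [Fintype ι] {E : ι → Type*}
    {mE : ∀ i, MeasurableSpace (E i)} {μ : ∀ i, Measure (E i)} [∀ i, SigmaFinite (μ i)]
    {f : ∀ i, E i → ℝ≥0∞} (hf : ∀ i, Measurable (f i)) :
    ∫⁻ x, ∏ i, f i (x i) ∂(Measure.pi μ) = ∏ i, ∫⁻ x, f i x ∂(μ i) := by
  let e := (Fintype.equivFin ι).symm
  rw [← (measurePreserving_piCongrLeft _ e).lintegral_comp_emb
    (MeasurableEquiv.measurableEmbedding _)]
  simp_rw [← e.prod_comp, MeasurableEquiv.coe_piCongrLeft, Equiv.piCongrLeft_apply_apply]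
  exact lintegral_fin_nat_prod_eq_prod fun i ↦ hf _

/-- A product of measures with densities has the product density. -/
theorem pi_withDensity {ι : Type*} [Fintype ι] {E : ι → Type*}
    {mE : ∀ i, MeasurableSpace (E i)} {μ : ∀ i, Measure (E i)} [∀ i, SigmaFinite (μ i)]
    {f : ∀ i, E i → ℝ≥0∞} (hf : ∀ i, Measurable (f i))
    [∀ i, SigmaFinite ((μ i).withDensity (f i))] :
    Measure.pi (fun i ↦ (μ i).withDensity (f i)) =
      (Measure.pi μ).withDensity (fun x ↦ ∏ i, f i (x i)) := by
  refine Measure.pi_eq fun s hs ↦ ?_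
  rw [withDensity_apply _ (MeasurableSet.univ_pi hs), ← lintegral_indicator (MeasurableSet.univ_pi hs)]
  have : ∀ x : ∀ i, E i, (Set.univ.pi s).indicator (fun x ↦ ∏ i, f i (x i)) x =
      ∏ i, (s i).indicator (f i) (x i) := by
    intro x
    classical
    by_cases hx : x ∈ Set.univ.pi s
    · rw [Set.indicator_of_mem hx]
      exact Finset.prod_congr rfl fun i _ ↦ (Set.indicator_of_mem (hx i trivial) _).symm
    · rw [Set.indicator_of_notMem hx]
      simp only [Set.mem_pi, Set.mem_univ, true_imp_iff, not_forall] at hx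
      obtain ⟨i, hi⟩ := hx
      exact (Finset.prod_eq_zero (Finset.mem_univ i) (Set.indicator_of_notMem hi _)).symm
  simp_rw [this]
  rw [lintegral_fintype_prod_eq_prod fun i ↦ (hf i).indicator (hs i)]
  refine Finset.prod_congr rfl fun i _ ↦ ?_
  rw [lintegral_indicator (hs i), withDensity_apply _ (hs i)]

/-- The density of `N(0, v)` with respect to `N(0, 1)`. -/
noncomputable def gaussianRatio (v : ℝ≥0) (x : ℝ) : ℝ :=
  Real.exp (-(1 / 2) * Real.log v - (1 / 2) * ((v : ℝ)⁻¹ - 1) * x ^ 2)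

@[fun_prop]
theorem measurable_gaussianRatio (v : ℝ≥0) : Measurable (gaussianRatio v) := by
  unfold gaussianRatio; fun_prop

theorem gaussianRatio_pos (v : ℝ≥0) (x : ℝ) : 0 < gaussianRatio v x := Real.exp_pos _

theorem gaussianReal_eq_withDensity_gaussianRatio {v : ℝ≥0} (hv : v ≠ 0) :
    gaussianReal 0 v = (gaussianReal 0 1).withDensity fun x ↦ ENNReal.ofReal (gaussianRatio v x) := by
  rw [gaussianReal_of_var_ne_zero _ hv, gaussianReal_of_var_ne_zero _ one_ne_zero,
    ← withDensity_mul _ (measurable_gaussianPDF 0 1) (by fun_prop)]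
  congr 1
  funext x
  rw [Pi.mul_apply, gaussianPDF, gaussianPDF, ← ENNReal.ofReal_mul (gaussianPDFReal_nonneg _ _ _)]
  congr 1
  have hv' : (0 : ℝ) < v := by positivity
  have hs : (Real.sqrt v)⁻¹ = Real.exp (-(1 / 2) * Real.log v) := by
    rw [Real.sqrt_eq_rpow, ← Real.rpow_neg hv'.le, Real.rpow_def_of_pos hv']
    congr 1; ring
  simp only [gaussianPDFReal, gaussianRatio, sub_zero, NNReal.coe_one, mul_one]
  rw [Real.sqrt_mul (by positivity), mul_inv, hs, mul_assoc, mul_assoc, ← Real.exp_add,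
    ← Real.exp_add]
  congr 2
  field_simp
  ring

section DiagonalGaussian

variable {Ω ι : Type*} [MeasurableSpace Ω] [Fintype ι] {P Q : Measure Ω}
  {f : Ω → ι → ℝ} {v : ι → ℝ≥0}

theorem pi_gaussianReal_eq_withDensity (hv : ∀ i, v i ≠ 0) :
    Measure.pi (fun i ↦ gaussianReal 0 (v i)) =
      (Measure.pi fun _ : ι ↦ gaussianReal 0 1).withDensity
        fun x ↦ ENNReal.ofReal (∏ i, gaussianRatio (v i) (x i)) := by
  have h : ∀ i, gaussianReal 0 (v i) = (gaussianReal 0 1).withDensity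
      fun x ↦ ENNReal.ofReal (gaussianRatio (v i) x) :=
    fun i ↦ gaussianReal_eq_withDensity_gaussianRatio (hv i)
  have : ∀ i, SigmaFinite ((gaussianReal 0 1).withDensity
      fun x ↦ ENNReal.ofReal (gaussianRatio (v i) x)) := fun i ↦ by rw [← h i]; infer_instance
  simp_rw [h]
  rw [pi_withDensity (fun i ↦ by fun_prop)]
  congr 1
  funext x
  rw [ENNReal.ofReal_prod_of_nonneg fun i _ ↦ (gaussianRatio_pos _ _).le]

theorem ac_of_map_eq_pi_gaussianReal (hf : MeasurableEmbedding f) (hv : ∀ i, v i ≠ 0)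
    (hP : P.map f = Measure.pi fun i ↦ gaussianReal 0 (v i))
    (hQ : Q.map f = Measure.pi fun _ ↦ gaussianReal 0 1) : P ≪ Q := by
  have h : P.map f ≪ Q.map f := by
    rw [hP, hQ, pi_gaussianReal_eq_withDensity hv]
    exact withDensity_absolutelyContinuous _ _
  refine Measure.AbsolutelyContinuous.mk fun s hs h0 ↦ ?_
  have h1 := h (s := f '' s)
  rw [hf.map_apply, hf.map_apply, hf.injective.preimage_image] at h1
  exact h1 h0

variable [IsProbabilityMeasure P] [IsProbabilityMeasure Q]

theorem llr_ae_eq_of_map_eq_pi_gaussianReal (hf : MeasurableEmbedding f) (hv : ∀ i, v i ≠ 0)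
    (hP : P.map f = Measure.pi fun i ↦ gaussianReal 0 (v i))
    (hQ : Q.map f = Measure.pi fun _ ↦ gaussianReal 0 1) :
    llr P Q =ᵐ[P] fun z ↦ ∑ i, (-(1 / 2) * Real.log (v i) -
      (1 / 2) * ((v i : ℝ)⁻¹ - 1) * f z i ^ 2) := by
  have hac := ac_of_map_eq_pi_gaussianReal hf hv hP hQ
  have h1 : (fun z ↦ (P.map f).rnDeriv (Q.map f) (f z)) =ᵐ[P] P.rnDeriv Q :=
    hac.ae_le (hf.rnDeriv_map P Q)
  have h2 : (P.map f).rnDeriv (Q.map f) =ᵐ[Q.map f]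
      fun x ↦ ENNReal.ofReal (∏ i, gaussianRatio (v i) (x i)) := by
    rw [hP, hQ, pi_gaussianReal_eq_withDensity hv]
    refine Measure.rnDeriv_withDensity _ ?_
    refine Measurable.ennreal_ofReal (Finset.measurable_prod _ fun i _ ↦ ?_)
    exact (measurable_gaussianRatio _).comp (measurable_pi_apply i)
  have h3 := hac.ae_le (ae_of_ae_map hf.measurable.aemeasurable h2)
  filter_upwards [h1, h3] with z hz1 hz3
  rw [llr, ← hz1, hz3, ENNReal.toReal_ofReal (Finset.prod_nonneg fun i _ ↦ (gaussianRatio_pos _ _).le),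
    Real.log_prod fun i _ ↦ (gaussianRatio_pos _ _).ne']
  exact Finset.sum_congr rfl fun i _ ↦ Real.log_exp _

theorem memLp_gaussian_summand (w : ℝ≥0) : MemLp (fun x : ℝ ↦ -(1 / 2) * Real.log w -
      (1 / 2) * ((w : ℝ)⁻¹ - 1) * x ^ 2) 2 (gaussianReal 0 w) :=
  (memLp_const _).sub ((memLp_sq_gaussianReal w).const_mul _)

theorem memLp_llr_of_map_eq_pi_gaussianReal (hf : MeasurableEmbedding f) (hv : ∀ i, v i ≠ 0)
    (hP : P.map f = Measure.pi fun i ↦ gaussianReal 0 (v i))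
    (hQ : Q.map f = Measure.pi fun _ ↦ gaussianReal 0 1) : MemLp (llr P Q) 2 P := by
  rw [memLp_congr_ae (llr_ae_eq_of_map_eq_pi_gaussianReal hf hv hP hQ)]
  refine memLp_finsetSum _ fun i _ ↦ ?_
  have hmp : MeasurePreserving (fun z ↦ f z i) P (gaussianReal 0 (v i)) :=
    (measurePreserving_eval (fun i ↦ gaussianReal 0 (v i)) i).comp ⟨hf.measurable, hP⟩
  exact (memLp_gaussian_summand (v i)).comp_measurePreserving hmp

theorem integral_llr_of_map_eq_pi_gaussianReal (hf : MeasurableEmbedding f) (hv : ∀ i, v i ≠ 0)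
    (hP : P.map f = Measure.pi fun i ↦ gaussianReal 0 (v i))
    (hQ : Q.map f = Measure.pi fun _ ↦ gaussianReal 0 1) :
    ∫ z, llr P Q z ∂P = ∑ i, (-(1 / 2) * Real.log (v i) - (1 / 2) * (1 - (v i : ℝ))) := by
  rw [integral_congr_ae (llr_ae_eq_of_map_eq_pi_gaussianReal hf hv hP hQ)]
  have hmp : ∀ i, MeasurePreserving (fun z ↦ f z i) P (gaussianReal 0 (v i)) := fun i ↦
    (measurePreserving_eval (fun i ↦ gaussianReal 0 (v i)) i).comp ⟨hf.measurable, hP⟩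
  rw [integral_finsetSum]
  · refine Finset.sum_congr rfl fun i _ ↦ ?_
    have hv' : (v i : ℝ) ≠ 0 := by simpa using hv i
    have := integral_map (hmp i).measurable.aemeasurable (f := fun x : ℝ ↦
      -(1 / 2) * Real.log (v i) - (1 / 2) * ((v i : ℝ)⁻¹ - 1) * x ^ 2) (by fun_prop) (μ := P)
    rw [← this, (hmp i).map_eq, integral_sub (integrable_const _)
      (((memLp_sq_gaussianReal _).integrable (by simp)).const_mul _), integral_const,
      integral_const_mul ((1 / 2) * ((v i : ℝ)⁻¹ - 1)), integral_sq_gaussianReal]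
    simp only [probReal_univ, one_smul]
    field_simp
  · intro i _
    exact ((memLp_gaussian_summand (v i)).comp_measurePreserving (hmp i)).integrable (by simp)

theorem variance_llr_of_map_eq_pi_gaussianReal (hf : MeasurableEmbedding f) (hv : ∀ i, v i ≠ 0)
    (hP : P.map f = Measure.pi fun i ↦ gaussianReal 0 (v i))
    (hQ : Q.map f = Measure.pi fun _ ↦ gaussianReal 0 1) :
    Var[llr P Q; P] = ∑ i, (1 / 2) * (1 - (v i : ℝ)) ^ 2 := by
  rw [variance_congr (llr_ae_eq_of_map_eq_pi_gaussianReal hf hv hP hQ)]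
  have h := variance_sum_pi (fun i ↦ memLp_gaussian_summand (v i))
  rw [← hP, variance_map (by fun_prop) hf.measurable.aemeasurable] at h
  have h2 : (∑ i, fun x : ι → ℝ ↦ -(1 / 2) * Real.log (v i) -
      (1 / 2) * ((v i : ℝ)⁻¹ - 1) * x i ^ 2) ∘ f = fun z ↦ ∑ i, (-(1 / 2) * Real.log (v i) -
      (1 / 2) * ((v i : ℝ)⁻¹ - 1) * f z i ^ 2) := by
    funext z; simp [Finset.sum_apply]
  rw [h2] at h
  rw [h]
  refine Finset.sum_congr rfl fun i _ ↦ ?_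
  have hv' : (v i : ℝ) ≠ 0 := by simpa using hv i
  rw [variance_const_sub (by fun_prop), variance_const_mul, variance_sq_gaussianReal]
  field_simp

end DiagonalGaussian

namespace PMIProfile

section General

variable {E : Type*} [NormedAddCommGroup E] [NormedSpace ℝ E] [MeasureSpace E]

theorem HasSmoothPosDensity.absolutelyContinuous {μ : Measure E} (h : HasSmoothPosDensity μ) :
    μ ≪ volume := by
  obtain ⟨p, -, -, rfl⟩ := h
  exact withDensity_absolutelyContinuous _ _

variable [BorelSpace E]

theorem HasSmoothPosDensity.comap {F : Type*} [NormedAddCommGroup F] [NormedSpace ℝ F]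
    [MeasureSpace F] [BorelSpace F] [FiniteDimensional ℝ F]
    [(volume : Measure F).IsAddHaarMeasure]
    [(volume : Measure E).IsAddHaarMeasure] {μ : Measure E} (T : E ≃L[ℝ] F) (c : F)
    (h : HasSmoothPosDensity (μ.map fun x ↦ T x - c)) : HasSmoothPosDensity μ := by
  obtain ⟨p, hp, hpos, hμ⟩ := h
  let e : E ≃ₜ F := T.toHomeomorph.trans (Homeomorph.subRight c)
  have hvol : ∃ a : ℝ≥0, a ≠ 0 ∧ (volume : Measure E).map e = a • volume := by
    have h1 : (volume : Measure E).map e = ((volume : Measure E).map T).map (fun y ↦ y - c) := by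
      rw [Measure.map_map (by fun_prop) T.continuous.measurable]; rfl
    rw [h1, (measurePreserving_sub_right _ c).map_eq]
    refine ⟨_, ?_, Measure.isAddLeftInvariant_eq_smul _ _⟩
    exact (Measure.addHaarScalarFactor_pos_of_isAddHaarMeasure _ _).ne'
  obtain ⟨a, ha, hvol⟩ := hvol
  have hem : MeasurableEmbedding e := e.measurableEmbedding
  refine ⟨fun x ↦ (a⁻¹ : ℝ≥0) * p (e x), ?_, fun x ↦ ?_, ?_⟩
  · exact contDiff_const.mul (hp.comp (T.contDiff.sub contDiff_const))
  · have : 0 < a⁻¹ := by positivity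
    exact mul_pos this (hpos _)
  · ext s hs
    have h2 : (μ.map e) (e '' s) = μ s := by
      rw [hem.map_apply, e.injective.preimage_image]
    have h3 : μ.map e = volume.withDensity fun x ↦ ENNReal.ofReal (p x) := hμ
    have hes : MeasurableSet (e '' s) := hem.measurableSet_image.2 hs
    have h4 : (volume : Measure F) = a⁻¹ • (volume : Measure E).map e := by
      rw [hvol, smul_smul, inv_mul_cancel₀ ha, one_smul]
    rw [← h2, h3, withDensity_apply _ hes, withDensity_apply _ hs, h4, Measure.restrict_smul,
      lintegral_smul_measure, hem.restrict_map, e.injective.preimage_image,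
      hem.lintegral_map]
    rw [ENNReal.smul_def, smul_eq_mul, ← lintegral_const_mul' _ _ (by simp)]
    refine lintegral_congr fun x ↦ ?_
    rw [ENNReal.ofReal_mul (by positivity), ENNReal.ofReal_coe_nnreal]

theorem hasSmoothPosDensity_pi_gaussianReal {ι : Type*} [Fintype ι] {v : ι → ℝ≥0}
    (hv : ∀ i, v i ≠ 0) : HasSmoothPosDensity (Measure.pi fun i ↦ gaussianReal 0 (v i)) := by
  refine ⟨fun x ↦ ∏ i, gaussianPDFReal 0 (v i) (x i), ?_, fun x ↦ ?_, ?_⟩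
  · refine contDiff_prod fun i _ ↦ ?_
    unfold gaussianPDFReal
    fun_prop
  · exact Finset.prod_pos fun i _ ↦ gaussianPDFReal_pos _ _ _ (hv i)
  · have : ∀ i, SigmaFinite ((volume : Measure ℝ).withDensity (gaussianPDF 0 (v i))) := fun i ↦ by
      rw [← gaussianReal_of_var_ne_zero _ (hv i)]; infer_instance
    simp_rw [gaussianReal_of_var_ne_zero _ (hv _)]
    rw [pi_withDensity (fun i ↦ measurable_gaussianPDF _ _), ← volume_pi]
    congr 1
    funext x
    rw [ENNReal.ofReal_prod_of_nonneg fun i _ ↦ gaussianPDFReal_nonneg _ _ _]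
    rfl

/-- Linear coordinates that diagonalize the covariance of a Gaussian measure are independent. -/
theorem map_eq_pi_gaussianReal {ι : Type*} [Fintype ι] [DecidableEq ι] {P : Measure E}
    [IsGaussian P] (T : E →L[ℝ] (ι → ℝ)) (v : ι → ℝ≥0)
    (hcov : ∀ i j, cov[fun x ↦ T x i, fun x ↦ T x j; P] = if i = j then (v i : ℝ) else 0) :
    P.map (fun x ↦ T x - fun i ↦ ∫ y, T y i ∂P) = Measure.pi fun i ↦ gaussianReal 0 (v i) := by
  set c : ι → ℝ := fun i ↦ ∫ y, T y i ∂P with hc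
  let π : ∀ i : ι, (ι → ℝ) →L[ℝ] ℝ := fun i ↦ ContinuousLinearMap.proj i
  have hT : ∀ i, Integrable (fun x ↦ T x i) P := fun i ↦
    IsGaussian.integrable_dual P ((π i).comp T)
  have hG : HasGaussianLaw (fun x ↦ fun i ↦ T x i - c i) P := by
    constructor
    have : IsGaussian ((P.map T).map fun y ↦ y - c) := inferInstance
    rw [Measure.map_map (by fun_prop) (by fun_prop)] at this
    exact this
  have hind : iIndepFun (fun i x ↦ T x i - c i) P := by
    refine hG.iIndepFun_of_covariance_eq_zero fun i j hij ↦ ?_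
    rw [covariance_sub_const_left (hT i), covariance_sub_const_right (hT j), hcov, if_neg hij]
  have h1 := (iIndepFun_iff_map_fun_eq_pi_map (fun i ↦ by fun_prop)).1 hind
  refine h1.trans ?_
  congr 1
  funext i
  have h2 : IsGaussian (P.map fun x ↦ T x i - c i) := by
    have : IsGaussian ((P.map ((π i).comp T)).map fun y ↦ y - c i) := inferInstance
    rw [Measure.map_map (by fun_prop) (by fun_prop)] at this
    exact this
  rw [h2.eq_gaussianReal]
  congr 1
  · rw [integral_map (by fun_prop) (by fun_prop)]
    simp only [id]
    rw [integral_sub (hT i) (integrable_const _)]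
    simp [hc]
  · rw [variance_map (by fun_prop) (by fun_prop)]
    simp only [Function.id_comp]
    rw [variance_sub_const (by fun_prop), ← covariance_self (by fun_prop), hcov, if_pos rfl,
      Real.toNNReal_coe]

variable [(volume : Measure E).IsAddHaarMeasure]

theorem hasSmoothPosDensity_of_covariance {ι : Type*} [Fintype ι] [DecidableEq ι] {P : Measure E}
    [IsGaussian P] (T : E ≃L[ℝ] (ι → ℝ)) {v : ι → ℝ≥0} (hv : ∀ i, v i ≠ 0)
    (hcov : ∀ i j, cov[fun x ↦ T x i, fun x ↦ T x j; P] = if i = j then (v i : ℝ) else 0) :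
    HasSmoothPosDensity P := by
  refine HasSmoothPosDensity.comap T (fun i ↦ ∫ y, T y i ∂P) ?_
  have := map_eq_pi_gaussianReal (T : E →L[ℝ] (ι → ℝ)) v hcov
  simp only [ContinuousLinearEquiv.coe_coe] at this
  rw [this]
  exact hasSmoothPosDensity_pi_gaussianReal hv

theorem variance_dual_pos [FiniteDimensional ℝ E] {P : Measure E} [IsGaussian P] (hP : P ≪ volume) {L : E →L[ℝ] ℝ}
    (hL : L ≠ 0) : 0 < Var[L; P] := by
  refine (variance_nonneg _ _).lt_of_ne fun h ↦ ?_
  have h1 := ae_eq_integral_of_variance_eq_zero (IsGaussian.memLp_dual P L 2 (by simp)) h.symm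
  obtain ⟨x, hx⟩ : ∃ x, L x ≠ 0 := by
    by_contra! hh
    exact hL (ContinuousLinearMap.ext hh)
  set a := ∫ y, L y ∂P
  let S : AffineSubspace ℝ E := AffineSubspace.comap L.toLinearMap.toAffineMap
    (AffineSubspace.mk' a (⊥ : Submodule ℝ ℝ))
  have hS : ∀ z, z ∈ S ↔ L z = a := by
    intro z
    simp [S, AffineSubspace.mem_comap, AffineSubspace.mem_mk', sub_eq_zero]
  have hne : S ≠ ⊤ := by
    intro htop
    have e0 : L 0 = a := (hS 0).1 (htop ▸ AffineSubspace.mem_top ℝ E 0)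
    have e1 : L x = a := (hS x).1 (htop ▸ AffineSubspace.mem_top ℝ E x)
    rw [map_zero] at e0
    exact hx (e1.trans e0.symm)
  have h0 : P (S : Set E) = 0 := hP (Measure.addHaar_affineSubspace volume S hne)
  have h2 : ∀ᵐ z ∂P, z ∉ (S : Set E) := measure_eq_zero_iff_ae_notMem.1 h0
  obtain ⟨z, hz1, hz2⟩ := (h1.and h2).exists
  exact hz2 ((hS z).2 hz1)

end General

section Pair

variable {m n : ℕ} {P : Measure (EuclideanSpace ℝ (Fin m) × EuclideanSpace ℝ (Fin n))}

/-- The pointwise mutual information is the log-likelihood ratio of the joint law with respect to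
the product of its marginals. -/
theorem pmi_ae_eq_llr (hP : IsNice P) : pmi P =ᵐ[P] llr P (P.fst.prod P.snd) := by
  obtain ⟨hprob, hd, hd1, hd2⟩ := hP
  have hac := hd.absolutelyContinuous
  obtain ⟨p, hp, hpos, hpe⟩ := hd1
  obtain ⟨q, hq, hqos, hqe⟩ := hd2
  have hpm : Measurable fun x ↦ ENNReal.ofReal (p x) := hp.continuous.measurable.ennreal_ofReal
  have hqm : Measurable fun x ↦ ENNReal.ofReal (q x) := hq.continuous.measurable.ennreal_ofReal
  have hprod : P.fst.prod P.snd = volume.withDensity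
      (fun z ↦ ENNReal.ofReal (p z.1) * ENNReal.ofReal (q z.2)) := by
    have : SFinite ((volume : Measure (EuclideanSpace ℝ (Fin n))).withDensity
      fun x ↦ ENNReal.ofReal (q x)) := by rw [← hqe]; infer_instance
    rw [hpe, hqe, prod_withDensity hpm hqm]
    rfl
  have hm : Measurable (fun z : EuclideanSpace ℝ (Fin m) × EuclideanSpace ℝ (Fin n) ↦
      ENNReal.ofReal (p z.1) * ENNReal.ofReal (q z.2)) :=
    (hpm.comp measurable_fst).mul (hqm.comp measurable_snd)
  have hacQ : (volume : Measure (EuclideanSpace ℝ (Fin m) × EuclideanSpace ℝ (Fin n))) ≪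
      P.fst.prod P.snd := by
    rw [hprod]
    refine withDensity_absolutelyContinuous' hm.aemeasurable (.of_forall fun z ↦ ?_)
    simpa using ⟨hpos z.1, hqos z.2⟩
  have e1 : ∀ᵐ z ∂P, P.rnDeriv (P.fst.prod P.snd) z * (P.fst.prod P.snd).rnDeriv volume z =
      P.rnDeriv volume z := hac.ae_le (Measure.rnDeriv_mul_rnDeriv (hac.trans hacQ))
  have e2 : ∀ᵐ z ∂P, (P.fst.prod P.snd).rnDeriv volume z =
      ENNReal.ofReal (p z.1) * ENNReal.ofReal (q z.2) := by
    refine hac.ae_le ?_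
    rw [hprod]
    exact Measure.rnDeriv_withDensity _ hm
  have e3 : ∀ᵐ z ∂P, P.fst.rnDeriv volume z.1 = ENNReal.ofReal (p z.1) := by
    have : P.fst.rnDeriv volume =ᵐ[P.fst] fun x ↦ ENNReal.ofReal (p x) := by
      have h := Measure.rnDeriv_withDensity (volume : Measure (EuclideanSpace ℝ (Fin m))) hpm
      rw [← hpe] at h
      exact (hpe ▸ withDensity_absolutelyContinuous _ _ : P.fst ≪ volume).ae_le h
    exact ae_of_ae_map measurable_fst.aemeasurable this
  have e4 : ∀ᵐ z ∂P, P.snd.rnDeriv volume z.2 = ENNReal.ofReal (q z.2) := by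
    have : P.snd.rnDeriv volume =ᵐ[P.snd] fun x ↦ ENNReal.ofReal (q x) := by
      have h := Measure.rnDeriv_withDensity (volume : Measure (EuclideanSpace ℝ (Fin n))) hqm
      rw [← hqe] at h
      exact (hqe ▸ withDensity_absolutelyContinuous _ _ : P.snd ≪ volume).ae_le h
    exact ae_of_ae_map measurable_snd.aemeasurable this
  filter_upwards [e1, e2, e3, e4] with z h1 h2 h3 h4
  rw [pmi, llr, ← h1, h2, h3, h4, ENNReal.toReal_mul, ENNReal.toReal_mul,
    ENNReal.toReal_ofReal (hpos _).le, ENNReal.toReal_ofReal (hqos _).le,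
    mul_div_cancel_right₀ _ (mul_pos (hpos _) (hqos _)).ne']

end Pair

end PMIProfile

namespace PMIProfile

section LinearAlgebra

open Matrix

theorem _root_.Matrix.IsHermitian.sum_one_sub_eigenvalues_sq {ι : Type*} [Fintype ι] [DecidableEq ι]
    {A : Matrix ι ι ℝ} (hA : A.IsHermitian) :
    ∑ i, (1 - hA.eigenvalues i) ^ 2 = ((1 - A) * (1 - A)).trace := by
  set U := hA.eigenvectorUnitary
  set D : Matrix ι ι ℝ := diagonal hA.eigenvalues
  have h1 : A = (U : Matrix ι ι ℝ) * D * (star U : Matrix ι ι ℝ) := by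
    conv_lhs => rw [hA.spectral_theorem]
    rfl
  have hU : (star U : Matrix ι ι ℝ) * (U : Matrix ι ι ℝ) = 1 := Unitary.coe_star_mul_self U
  have hU' : (U : Matrix ι ι ℝ) * (star U : Matrix ι ι ℝ) = 1 := Unitary.coe_mul_star_self U
  have h2 : 1 - A = (U : Matrix ι ι ℝ) * (1 - D) * (star U : Matrix ι ι ℝ) := by
    rw [mul_sub, mul_one, sub_mul, hU', ← h1]
  have h3 : (1 - A) * (1 - A) = (U : Matrix ι ι ℝ) * ((1 - D) * (1 - D) * (star U : Matrix ι ι ℝ)) := by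
    rw [h2]
    calc _ = (U : Matrix ι ι ℝ) * (1 - D) * ((star U : Matrix ι ι ℝ) * (U : Matrix ι ι ℝ)) *
          (1 - D) * (star U : Matrix ι ι ℝ) := by simp only [mul_assoc]
      _ = _ := by rw [hU]; simp only [mul_assoc, mul_one]
  rw [h3, trace_mul_comm, mul_assoc, hU, mul_one, ← diagonal_one, diagonal_sub, diagonal_mul_diagonal,
    trace_diagonal]
  simp [sq]

variable {m n : ℕ} (C : Matrix (Fin m) (Fin n) ℝ)

theorem trace_fromBlocks_eq_add (A : Matrix (Fin m) (Fin m) ℝ) (B : Matrix (Fin m) (Fin n) ℝ)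
    (B' : Matrix (Fin n) (Fin m) ℝ) (D : Matrix (Fin n) (Fin n) ℝ) :
    (fromBlocks A B B' D).trace = A.trace + D.trace := by
  simp [trace, Fintype.sum_sum_type]

theorem isHermitian_fromBlocks_one : (fromBlocks 1 C Cᵀ 1).IsHermitian := by
  rw [IsHermitian, conjTranspose_eq_transpose_of_trivial, fromBlocks_transpose]
  simp

theorem sum_eigenvalues_fromBlocks_one :
    ∑ i, (1 - (isHermitian_fromBlocks_one C).eigenvalues i) = 0 := by
  have h := (isHermitian_fromBlocks_one C).trace_eq_sum_eigenvalues
  rw [trace_fromBlocks_eq_add] at h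
  simp only [trace_one, Fintype.card_fin, RCLike.ofReal_real_eq_id, id] at h
  rw [Finset.sum_sub_distrib, ← h]
  simp

theorem sum_one_sub_eigenvalues_sq_fromBlocks_one :
    ∑ i, (1 - (isHermitian_fromBlocks_one C).eigenvalues i) ^ 2 = 2 * (Cᵀ * C).trace := by
  rw [IsHermitian.sum_one_sub_eigenvalues_sq]
  have : (1 : Matrix (Fin m ⊕ Fin n) (Fin m ⊕ Fin n) ℝ) - fromBlocks 1 C Cᵀ 1 =
      fromBlocks 0 (-C) (-Cᵀ) 0 := by
    rw [← fromBlocks_one, sub_eq_add_neg, fromBlocks_neg, fromBlocks_add]; simp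
  rw [this, fromBlocks_multiply, trace_fromBlocks_eq_add]
  simp [trace_mul_comm C]
  ring

theorem prod_eigenvalues_fromBlocks_one :
    ∏ i, (isHermitian_fromBlocks_one C).eigenvalues i = (1 - Cᵀ * C).det := by
  have h := (isHermitian_fromBlocks_one C).det_eq_prod_eigenvalues
  rw [det_fromBlocks_one₁₁] at h
  simpa using h.symm

theorem adjoint_comp_toLpLin :
    LinearMap.adjoint (toLpLin 2 2 C) ∘ₗ toLpLin 2 2 C = toLpLin 2 2 (Cᵀ * C) := by
  have h := toEuclideanLin_conjTranspose_eq_adjoint C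
  rw [conjTranspose_eq_transpose_of_trivial] at h
  rw [toLpLin_mul (q := 2)]
  exact congrArg (· ∘ₗ _) h.symm

theorem toMatrix_toLpLin (A : Matrix (Fin n) (Fin n) ℝ) :
    LinearMap.toMatrix (EuclideanSpace.basisFun (Fin n) ℝ).toBasis
      (EuclideanSpace.basisFun (Fin n) ℝ).toBasis (toLpLin 2 2 A) = A := by
  ext i j
  simp [LinearMap.toMatrix_apply, toLpLin_apply]

theorem charpoly_toLpLin_mul :
    (toLpLin 2 2 (Cᵀ * C)).charpoly = (Cᵀ * C).charpoly := by
  rw [← LinearMap.charpoly_toMatrix _ (EuclideanSpace.basisFun (Fin n) ℝ).toBasis,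
    toMatrix_toLpLin]

theorem singularValues_eq_zero_of_min_le {i : ℕ} (hi : min m n ≤ i) :
    (toLpLin 2 2 C).singularValues i = 0 := by
  rw [LinearMap.singularValues_eq_zero_iff_le_finrank_range]
  refine le_trans (le_min ?_ ?_) hi
  · exact (Submodule.finrank_le _).trans_eq (by simp)
  · exact (LinearMap.finrank_range_le _).trans_eq (by simp)

@[to_additive]
theorem prod_fin_min_eq {M : Type*} [CommMonoid M] (g : ℕ → M)
    (hg : ∀ i, min m n ≤ i → i < n → g i = 1) :
    ∏ i : Fin (min m n), g i = ∏ i : Fin n, g i := by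
  rw [Fin.prod_univ_eq_prod_range, Fin.prod_univ_eq_prod_range]
  refine Finset.prod_subset (Finset.range_mono (min_le_right _ _)) fun i hi hi' ↦ hg i ?_ ?_
  · exact not_lt.1 fun h ↦ hi' (Finset.mem_range.2 h)
  · exact Finset.mem_range.1 hi

theorem sum_sq_singularValues :
    ∑ i : Fin (min m n), (toLpLin 2 2 C).singularValues i ^ 2 = (Cᵀ * C).trace := by
  rw [sum_fin_min_eq (m := m) (n := n) (fun i ↦ (toLpLin 2 2 C).singularValues i ^ 2)
    fun i hi _ ↦ by simp [singularValues_eq_zero_of_min_le C hi]]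
  have hn : Module.finrank ℝ (EuclideanSpace ℝ (Fin n)) = n := by simp
  simp_rw [LinearMap.sq_singularValues_fin _ hn]
  have h3 := (toLpLin 2 2 C).isSymmetric_adjoint_comp_self.trace_eq_sum_eigenvalues hn
  simp only [RCLike.ofReal_real_eq_id, id] at h3
  rw [← h3, adjoint_comp_toLpLin, LinearMap.trace_eq_matrix_trace ℝ
    (EuclideanSpace.basisFun (Fin n) ℝ).toBasis,
    toMatrix_toLpLin]

theorem prod_one_sub_sq_singularValues :
    ∏ i : Fin (min m n), (1 - (toLpLin 2 2 C).singularValues i ^ 2) = (1 - Cᵀ * C).det := by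
  rw [prod_fin_min_eq (m := m) (n := n) (fun i ↦ 1 - (toLpLin 2 2 C).singularValues i ^ 2)
    fun i hi _ ↦ by simp [singularValues_eq_zero_of_min_le C hi]]
  have hn : Module.finrank ℝ (EuclideanSpace ℝ (Fin n)) = n := by simp
  simp_rw [LinearMap.sq_singularValues_fin _ hn]
  have h := (toLpLin 2 2 C).isSymmetric_adjoint_comp_self.charpoly_eq hn
  have h' := charpoly_toLpLin_mul C
  rw [← adjoint_comp_toLpLin, h] at h'
  have h3 := congrArg (Polynomial.eval 1) h'
  rw [eval_charpoly, Polynomial.eval_prod] at h3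
  simpa using h3

theorem sq_singularValues_lt_one (hC : (fromBlocks 1 C Cᵀ 1).PosDef) (i : Fin (min m n)) :
    (toLpLin 2 2 C).singularValues i ^ 2 < 1 := by
  have hn : Module.finrank ℝ (EuclideanSpace ℝ (Fin n)) = n := by simp
  have hi : (i : ℕ) < n := i.2.trans_le (min_le_right _ _)
  have hne : 1 - (toLpLin 2 2 C).singularValues i ^ 2 ≠ 0 := by
    have h1 : (1 - Cᵀ * C).det ≠ 0 := by
      have := hC.det_pos
      rw [det_fromBlocks_one₁₁] at this
      exact this.ne'
    rw [← prod_one_sub_sq_singularValues] at h1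
    exact Finset.prod_ne_zero_iff.1 h1 i (Finset.mem_univ i)
  have hle : (toLpLin 2 2 C).singularValues i ^ 2 ≤ 1 := by
    have hpsd : (1 - Cᵀ * C).PosSemidef := by
      let : Invertible (1 : Matrix (Fin m) (Fin m) ℝ) := invertibleOne
      have := (PosDef.one (n := Fin m) (R := ℝ)).fromBlocks₁₁ C 1
      rw [conjTranspose_eq_transpose_of_trivial] at this
      simpa using this.1 hC.posSemidef
    set hT := (toLpLin 2 2 C).isSymmetric_adjoint_comp_self
    set x := hT.eigenvectorBasis hn ⟨i, hi⟩
    have hx : toLpLin 2 2 (Cᵀ * C) x = ((toLpLin 2 2 C).singularValues i ^ 2) • x := by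
      rw [← adjoint_comp_toLpLin, LinearMap.sq_singularValues_of_lt _ hn hi]
      exact hT.apply_eigenvectorBasis hn ⟨i, hi⟩
    have hx' : (Cᵀ * C) *ᵥ x.ofLp = ((toLpLin 2 2 C).singularValues i ^ 2) • x.ofLp := by
      have := congrArg WithLp.ofLp hx
      simpa [toLpLin_apply] using this
    have hnorm : x.ofLp ⬝ᵥ x.ofLp = 1 := by
      have h1 : ‖x‖ = 1 := (hT.eigenvectorBasis hn).orthonormal.1 _
      have h2 : inner ℝ x x = 1 := by rw [real_inner_self_eq_norm_sq, h1]; norm_num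
      rwa [EuclideanSpace.inner_eq_star_dotProduct, star_trivial] at h2
    have h3 := hpsd.dotProduct_mulVec_nonneg x.ofLp
    rw [sub_mulVec, one_mulVec, hx', star_trivial, dotProduct_sub, dotProduct_smul, hnorm] at h3
    simpa using h3
  exact lt_of_le_of_ne hle fun h ↦ hne (by rw [h, sub_self])

end LinearAlgebra

/-- The Jensen inequality behind the bound. -/
theorem sum_le_of_sum_log {k : ℕ} (hk : 0 < k) {s : Fin k → ℝ} (hs : ∀ i, s i < 1) :
    ∑ i, s i ≤ k * (1 - Real.exp ((∑ i, Real.log (1 - s i)) / k)) := by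
  have hk' : (0 : ℝ) < k := by exact_mod_cast hk
  have h := convexOn_exp.map_sum_le (t := Finset.univ) (w := fun _ : Fin k ↦ (k : ℝ)⁻¹)
    (p := fun i ↦ Real.log (1 - s i)) (by intros; positivity) (by simp [hk'.ne']) (by simp)
  simp_rw [Real.exp_log (sub_pos.2 (hs _)), smul_eq_mul, ← Finset.mul_sum] at h
  rw [Finset.sum_sub_distrib] at h
  simp only [Finset.sum_const, Finset.card_univ, Fintype.card_fin, nsmul_eq_mul, mul_one] at h
  rw [inv_mul_eq_div, inv_mul_eq_div, le_div_iff₀ hk'] at h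
  linarith

theorem sum_eq_iff_of_sum_log {k : ℕ} (hk : 0 < k) {s : Fin k → ℝ} (hs : ∀ i, s i < 1) :
    ∑ i, s i = k * (1 - Real.exp ((∑ i, Real.log (1 - s i)) / k)) ↔ ∀ i j, s i = s j := by
  have hk' : (0 : ℝ) < k := by exact_mod_cast hk
  have h := strictConvexOn_exp.map_sum_eq_iff (t := Finset.univ) (w := fun _ : Fin k ↦ (k : ℝ)⁻¹)
    (p := fun i ↦ Real.log (1 - s i)) (by intros; positivity) (by simp [hk'.ne']) (by simp)
  simp_rw [Real.exp_log (sub_pos.2 (hs _)), smul_eq_mul, ← Finset.mul_sum] at h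
  rw [Finset.sum_sub_distrib] at h
  simp only [Finset.sum_const, Finset.card_univ, Fintype.card_fin, nsmul_eq_mul, mul_one,
    Finset.mem_univ, true_imp_iff] at h
  rw [inv_mul_eq_div, inv_mul_eq_div, eq_div_iff hk'.ne'] at h
  have hinj : ∀ i j, Real.log (1 - s i) = Real.log (1 - s j) → s i = s j := fun i j hij ↦ by
    have := Real.log_injOn_pos (sub_pos.2 (hs i)) (sub_pos.2 (hs j)) hij
    linarith
  have h2 : (∑ i, s i = k * (1 - Real.exp ((∑ i, Real.log (1 - s i)) / k))) ↔
      (Real.exp ((∑ i, Real.log (1 - s i)) / k) * k = k - ∑ i, s i) := by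
    constructor <;> intro h <;> linarith
  rw [h2, h]
  constructor
  · exact fun h i j ↦ hinj i j ((h i).trans (h j).symm)
  · intro h j
    rw [Finset.sum_congr rfl fun i _ ↦ by rw [h i j]]
    simp [hk'.ne']

end PMIProfile

namespace PMIProfile

open Matrix

variable {m n : ℕ}

theorem _root_.Matrix.PosDef.sqrt_inv_spec {ι : Type*} [Fintype ι] [DecidableEq ι]
    {A : Matrix ι ι ℝ} (hA : A.PosDef) :
    (CFC.sqrt A⁻¹)ᵀ = CFC.sqrt A⁻¹ ∧ CFC.sqrt A⁻¹ * A * CFC.sqrt A⁻¹ = 1 := by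
  have h0 : 0 ≤ A⁻¹ := Matrix.nonneg_iff_posSemidef.2 hA.inv.posSemidef
  have h1 : CFC.sqrt A⁻¹ * CFC.sqrt A⁻¹ = A⁻¹ := CFC.sqrt_mul_sqrt_self _ h0
  constructor
  · have : (CFC.sqrt A⁻¹).PosSemidef := Matrix.nonneg_iff_posSemidef.1 (CFC.sqrt_nonneg _)
    rw [← conjTranspose_eq_transpose_of_trivial]
    exact this.isHermitian
  · rw [mul_eq_one_comm, ← mul_assoc, h1, nonsing_inv_mul _ hA.det_pos.ne'.isUnit]

/-- A component of a continuous linear equivalence with a space of families. -/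
noncomputable def component {E κ : Type*} [NormedAddCommGroup E] [NormedSpace ℝ E]
    (T : E ≃L[ℝ] (κ → ℝ)) (i : κ) : E →L[ℝ] ℝ :=
  (ContinuousLinearMap.proj (R := ℝ) (φ := fun _ : κ ↦ ℝ) i).comp T.toContinuousLinearMap

theorem component_apply {E κ : Type*} [NormedAddCommGroup E] [NormedSpace ℝ E]
    (T : E ≃L[ℝ] (κ → ℝ)) (i : κ) (x : E) : component T i x = T x i := rfl

/-- The coordinates on `ℝᵐ × ℝⁿ`. -/
noncomputable def coord (m n : ℕ) :
    (EuclideanSpace ℝ (Fin m) × EuclideanSpace ℝ (Fin n)) ≃ₗ[ℝ] (Fin m ⊕ Fin n → ℝ) where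
  toFun z := Sum.elim z.1 z.2
  invFun w := (WithLp.toLp 2 fun i ↦ w (.inl i), WithLp.toLp 2 fun j ↦ w (.inr j))
  map_add' x y := by ext i; cases i <;> rfl
  map_smul' c x := by ext i; cases i <;> rfl
  left_inv z := rfl
  right_inv w := by ext i; cases i <;> rfl

/-- The coordinates on `ℝᵐ × ℝⁿ` composed with an invertible matrix. -/
noncomputable def coordEquiv {M M' : Matrix (Fin m ⊕ Fin n) (Fin m ⊕ Fin n) ℝ}
    (h : M * M' = 1) :
    (EuclideanSpace ℝ (Fin m) × EuclideanSpace ℝ (Fin n)) ≃L[ℝ] (Fin m ⊕ Fin n → ℝ) :=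
  ((coord m n).trans (toLin'OfInv (mul_eq_one_comm.1 h) h)).toContinuousLinearEquiv

theorem coordEquiv_apply {M M' : Matrix (Fin m ⊕ Fin n) (Fin m ⊕ Fin n) ℝ} (h : M * M' = 1)
    (z : EuclideanSpace ℝ (Fin m) × EuclideanSpace ℝ (Fin n)) (i : Fin m ⊕ Fin n) :
    coordEquiv h z i = ∑ k, M i k * coord m n z k := rfl

variable (μ : Measure (EuclideanSpace ℝ (Fin m) × EuclideanSpace ℝ (Fin n))) [IsGaussian μ]

/-- The joint covariance matrix. -/
noncomputable def jointCov (μ : Measure (EuclideanSpace ℝ (Fin m) × EuclideanSpace ℝ (Fin n))) :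
    Matrix (Fin m ⊕ Fin n) (Fin m ⊕ Fin n) ℝ :=
  fromBlocks (covX μ) (covXY μ) (covXY μ)ᵀ (covY μ)

theorem memLp_coord (i : Fin m ⊕ Fin n) : MemLp (fun z ↦ coord m n z i) 2 μ :=
  IsGaussian.memLp_dual μ (component (coord m n).toContinuousLinearEquiv i) 2 (by simp)

omit [IsGaussian μ] in
theorem covariance_coord (i j : Fin m ⊕ Fin n) :
    cov[fun z ↦ coord m n z i, fun z ↦ coord m n z j; μ] = jointCov μ i j := by
  cases i <;> cases j
  · rfl
  · rfl
  · exact covariance_comm _ _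
  · rfl

theorem covariance_coordEquiv {M M' : Matrix (Fin m ⊕ Fin n) (Fin m ⊕ Fin n) ℝ} (h : M * M' = 1)
    (i j : Fin m ⊕ Fin n) :
    cov[fun z ↦ coordEquiv h z i, fun z ↦ coordEquiv h z j; μ] = (M * jointCov μ * Mᵀ) i j := by
  simp_rw [coordEquiv_apply]
  rw [covariance_fun_sum_fun_sum (fun k ↦ (memLp_coord μ k).const_mul _)
    (fun k ↦ (memLp_coord μ k).const_mul _)]
  simp_rw [covariance_const_mul_left, covariance_const_mul_right, covariance_coord, mul_apply,
    Finset.sum_mul, transpose_apply]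
  rw [Finset.sum_comm]
  exact Finset.sum_congr rfl fun k _ ↦ Finset.sum_congr rfl fun l _ ↦ by ring

instance : IsGaussian μ.fst :=
  isGaussian_map (ContinuousLinearMap.fst ℝ (EuclideanSpace ℝ (Fin m)) (EuclideanSpace ℝ (Fin n)))

instance : IsGaussian μ.snd :=
  isGaussian_map (ContinuousLinearMap.snd ℝ (EuclideanSpace ℝ (Fin m)) (EuclideanSpace ℝ (Fin n)))

instance : (volume : Measure (EuclideanSpace ℝ (Fin m) × EuclideanSpace ℝ (Fin n))).IsAddHaarMeasure :=
  inferInstanceAs (((volume : Measure (EuclideanSpace ℝ (Fin m))).prod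
    (volume : Measure (EuclideanSpace ℝ (Fin n)))).IsAddHaarMeasure)

omit [IsGaussian μ] in
theorem covX_eq_fst : covX μ = of fun i j ↦ cov[fun x ↦ x i, fun x ↦ x j; μ.fst] := by
  ext i j
  rw [covX, of_apply, of_apply, Measure.fst, covariance_map (by fun_prop) (by fun_prop)
    measurable_fst.aemeasurable]
  rfl

omit [IsGaussian μ] in
theorem covY_eq_snd : covY μ = of fun i j ↦ cov[fun x ↦ x i, fun x ↦ x j; μ.snd] := by
  ext i j
  rw [covY, of_apply, of_apply, Measure.snd, covariance_map (by fun_prop) (by fun_prop)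
    measurable_snd.aemeasurable]
  rfl

theorem covXY_prod : covXY (μ.fst.prod μ.snd) = 0 := by
  ext i j
  refine covariance_fst_snd_prod (X := fun x : EuclideanSpace ℝ (Fin m) ↦ x i)
    (Y := fun x : EuclideanSpace ℝ (Fin n) ↦ x j) ?_ ?_
  · exact IsGaussian.memLp_dual μ.fst (EuclideanSpace.proj i) 2 (by simp)
  · exact IsGaussian.memLp_dual μ.snd (EuclideanSpace.proj j) 2 (by simp)

theorem jointCov_prod : jointCov (μ.fst.prod μ.snd) = fromBlocks (covX μ) 0 0 (covY μ) := by
  rw [jointCov, covXY_prod, covX_eq_fst, covY_eq_snd, Measure.fst_prod, Measure.snd_prod,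
    ← covX_eq_fst, ← covY_eq_snd, transpose_zero]

theorem integral_dual_prod (L : (EuclideanSpace ℝ (Fin m) × EuclideanSpace ℝ (Fin n)) →L[ℝ] ℝ) :
    ∫ z, L z ∂(μ.fst.prod μ.snd) = ∫ z, L z ∂μ := by
  have h : ∀ ν : Measure (EuclideanSpace ℝ (Fin m) × EuclideanSpace ℝ (Fin n)), IsGaussian ν →
      ∫ z, L z ∂ν = ∫ x, L (x, 0) ∂ν.fst + ∫ y, L (0, y) ∂ν.snd := by
    intro ν hν
    rw [Measure.fst, Measure.snd, integral_map (by fun_prop) (by fun_prop),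
      integral_map (by fun_prop) (by fun_prop), ← integral_add]
    · refine integral_congr_ae (.of_forall fun z ↦ ?_)
      simp only
      rw [← map_add]
      simp
    · exact IsGaussian.integrable_dual ν
        (L.comp ((ContinuousLinearMap.inl ℝ _ _).comp (ContinuousLinearMap.fst ℝ _ _)))
    · exact IsGaussian.integrable_dual ν
        (L.comp ((ContinuousLinearMap.inr ℝ _ _).comp (ContinuousLinearMap.snd ℝ _ _)))
  rw [h _ inferInstance, h _ inferInstance, Measure.fst_prod, Measure.snd_prod]

variable {μ}

theorem jointCov_posDef (hμ : μ ≪ volume) : (jointCov μ).PosDef := by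
  have hH : (jointCov μ).IsHermitian := by
    have : ∀ i j, jointCov μ i j = jointCov μ j i := fun i j ↦ by
      rw [← covariance_coord, ← covariance_coord, covariance_comm]
    ext i j
    simpa using this j i
  refine PosDef.of_dotProduct_mulVec_pos hH fun x hx ↦ ?_
  let L : (EuclideanSpace ℝ (Fin m) × EuclideanSpace ℝ (Fin n)) →L[ℝ] ℝ :=
    ∑ i, x i • component (coord m n).toContinuousLinearEquiv i
  have hLa : ∀ z, L z = ∑ i, x i * coord m n z i := fun z ↦ by
    simp [L, component_apply]
  have hL : L ≠ 0 := by
    intro h0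
    have := hLa ((coord m n).symm x)
    rw [h0] at this
    simp only [LinearEquiv.apply_symm_apply, _root_.zero_apply] at this
    exact hx (dotProduct_self_eq_zero.1 this.symm)
  have hpos := variance_dual_pos hμ hL
  have hfun : (L : _ → ℝ) = fun z ↦ ∑ i, x i * coord m n z i := funext hLa
  rw [← covariance_self (by fun_prop), hfun,
    covariance_fun_sum_fun_sum (fun k ↦ (memLp_coord μ k).const_mul _)
    (fun k ↦ (memLp_coord μ k).const_mul _)] at hpos
  simp_rw [covariance_const_mul_left, covariance_const_mul_right, covariance_coord] at hpos
  refine hpos.trans_eq ?_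
  simp only [dotProduct, mulVec, star_trivial, Finset.mul_sum]
  exact Finset.sum_congr rfl fun k _ ↦ Finset.sum_congr rfl fun l _ ↦ by ring

theorem covX_posDef (hμ : μ ≪ volume) : (covX μ).PosDef :=
  (jointCov_posDef hμ).submatrix (e := Sum.inl) Sum.inl_injective

theorem covY_posDef (hμ : μ ≪ volume) : (covY μ).PosDef :=
  (jointCov_posDef hμ).submatrix (e := Sum.inr) Sum.inr_injective

/-- The joint covariance matrix of the whitened variables. -/
noncomputable def whitenedJointCov
    (μ : Measure (EuclideanSpace ℝ (Fin m) × EuclideanSpace ℝ (Fin n))) :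
    Matrix (Fin m ⊕ Fin n) (Fin m ⊕ Fin n) ℝ :=
  fromBlocks 1 (whitenedCov μ) (whitenedCov μ)ᵀ 1

/-- The matrix that whitens both variables. -/
noncomputable def whitening
    (μ : Measure (EuclideanSpace ℝ (Fin m) × EuclideanSpace ℝ (Fin n))) :
    Matrix (Fin m ⊕ Fin n) (Fin m ⊕ Fin n) ℝ :=
  fromBlocks (CFC.sqrt (covX μ)⁻¹) 0 0 (CFC.sqrt (covY μ)⁻¹)

theorem whitening_mul_jointCov (hμ : μ ≪ volume) :
    whitening μ * jointCov μ * (whitening μ)ᵀ = whitenedJointCov μ := by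
  obtain ⟨hx, hx'⟩ := (covX_posDef hμ).sqrt_inv_spec
  obtain ⟨hy, hy'⟩ := (covY_posDef hμ).sqrt_inv_spec
  simp only [whitening, jointCov, whitenedJointCov, fromBlocks_transpose, fromBlocks_multiply,
    transpose_zero, hx, hy, Matrix.zero_mul, Matrix.mul_zero, add_zero, zero_add, hx', hy',
    whitenedCov, transpose_mul, Matrix.mul_assoc]

theorem whitening_mul_jointCov_prod (hμ : μ ≪ volume) :
    whitening μ * jointCov (μ.fst.prod μ.snd) * (whitening μ)ᵀ = 1 := by
  obtain ⟨hx, hx'⟩ := (covX_posDef hμ).sqrt_inv_spec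
  obtain ⟨hy, hy'⟩ := (covY_posDef hμ).sqrt_inv_spec
  rw [jointCov_prod]
  simp only [whitening, fromBlocks_transpose, fromBlocks_multiply,
    transpose_zero, hx, hy, Matrix.zero_mul, Matrix.mul_zero, add_zero, zero_add, hx', hy',
    fromBlocks_one]

theorem _root_.Matrix.IsHermitian.star_eigenvectorUnitary_mul {ι : Type*} [Fintype ι] [DecidableEq ι]
    {A : Matrix ι ι ℝ} (hA : A.IsHermitian) :
    (hA.eigenvectorUnitary : Matrix ι ι ℝ)ᵀ * A * hA.eigenvectorUnitary =
      diagonal hA.eigenvalues := by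
  have h1 : A = (hA.eigenvectorUnitary : Matrix ι ι ℝ) * diagonal hA.eigenvalues *
      (hA.eigenvectorUnitary : Matrix ι ι ℝ)ᵀ := by
    conv_lhs => rw [hA.spectral_theorem]
    rfl
  have hU : (hA.eigenvectorUnitary : Matrix ι ι ℝ)ᵀ * (hA.eigenvectorUnitary : Matrix ι ι ℝ) = 1 :=
    Unitary.coe_star_mul_self hA.eigenvectorUnitary
  calc _ = (hA.eigenvectorUnitary : Matrix ι ι ℝ)ᵀ * ((hA.eigenvectorUnitary : Matrix ι ι ℝ) *
        diagonal hA.eigenvalues * (hA.eigenvectorUnitary : Matrix ι ι ℝ)ᵀ) *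
          hA.eigenvectorUnitary := by rw [← h1]
    _ = ((hA.eigenvectorUnitary : Matrix ι ι ℝ)ᵀ * (hA.eigenvectorUnitary : Matrix ι ι ℝ)) *
        diagonal hA.eigenvalues * ((hA.eigenvectorUnitary : Matrix ι ι ℝ)ᵀ *
          (hA.eigenvectorUnitary : Matrix ι ι ℝ)) := by simp only [Matrix.mul_assoc]
    _ = _ := by rw [hU, Matrix.one_mul, Matrix.mul_one]

omit [IsGaussian μ] in
theorem whitenedJointCov_isHermitian : (whitenedJointCov μ).IsHermitian :=
  isHermitian_fromBlocks_one _

/-- There are linear coordinates that diagonalize the covariance of the joint law and whiten the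
product of the marginals. -/
theorem exists_diagonalizing (hμ : μ ≪ volume) :
    ∃ T : (EuclideanSpace ℝ (Fin m) × EuclideanSpace ℝ (Fin n)) ≃L[ℝ] (Fin m ⊕ Fin n → ℝ),
      (∀ i j, cov[fun z ↦ T z i, fun z ↦ T z j; μ] =
        if i = j then (whitenedJointCov_isHermitian (μ := μ)).eigenvalues i else 0) ∧
      (∀ i j, cov[fun z ↦ T z i, fun z ↦ T z j; μ.fst.prod μ.snd] = if i = j then 1 else 0) := by
  set hA := whitenedJointCov_isHermitian (μ := μ)
  set U : Matrix (Fin m ⊕ Fin n) (Fin m ⊕ Fin n) ℝ := hA.eigenvectorUnitary.1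
  have hU : Uᵀ * U = 1 := Unitary.coe_star_mul_self hA.eigenvectorUnitary
  have hprod : (Uᵀ * whitening μ) * (jointCov (μ.fst.prod μ.snd) * (whitening μ)ᵀ * U) = 1 := by
    have := whitening_mul_jointCov_prod hμ
    calc _ = Uᵀ * (whitening μ * jointCov (μ.fst.prod μ.snd) * (whitening μ)ᵀ) * U := by
          simp only [Matrix.mul_assoc]
      _ = 1 := by rw [this, Matrix.mul_one, hU]
  refine ⟨coordEquiv hprod, fun i j ↦ ?_, fun i j ↦ ?_⟩
  · rw [covariance_coordEquiv]
    have : Uᵀ * whitening μ * jointCov μ * (Uᵀ * whitening μ)ᵀ = diagonal hA.eigenvalues := by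
      refine Eq.trans ?_ hA.star_eigenvectorUnitary_mul
      refine Eq.trans ?_ (congrArg (fun B ↦ Uᵀ * B * U) (whitening_mul_jointCov hμ))
      rw [transpose_mul, transpose_transpose]
      simp only [Matrix.mul_assoc]
    rw [this, diagonal_apply]
  · rw [covariance_coordEquiv, transpose_mul, transpose_transpose, Matrix.mul_assoc,
      ← Matrix.mul_assoc _ _ U, hprod, one_apply]

theorem whitenedJointCov_eigenvalues_pos (hμ : μ ≪ volume) (i : Fin m ⊕ Fin n) :
    0 < (whitenedJointCov_isHermitian (μ := μ)).eigenvalues i := by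
  obtain ⟨T, hT, -⟩ := exists_diagonalizing hμ
  have h := hT i i
  rw [if_pos rfl, covariance_self (by fun_prop)] at h
  rw [← h]
  refine variance_dual_pos hμ (L := component T i) fun h0 ↦ ?_
  have := DFunLike.congr_fun h0 (T.symm (Pi.single i 1))
  simp [component_apply] at this

theorem whitenedJointCov_posDef (hμ : μ ≪ volume) : (whitenedJointCov μ).PosDef :=
  whitenedJointCov_isHermitian.posDef_iff_eigenvalues_pos.2 (whitenedJointCov_eigenvalues_pos hμ)

theorem exists_map_eq_pi (hμ : μ ≪ volume) :
    ∃ f : EuclideanSpace ℝ (Fin m) × EuclideanSpace ℝ (Fin n) → Fin m ⊕ Fin n → ℝ,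
      MeasurableEmbedding f ∧
      μ.map f = Measure.pi (fun i ↦ gaussianReal 0
        ((whitenedJointCov_isHermitian (μ := μ)).eigenvalues i).toNNReal) ∧
      (μ.fst.prod μ.snd).map f = Measure.pi fun _ ↦ gaussianReal 0 1 := by
  obtain ⟨T, hT, hT'⟩ := exists_diagonalizing hμ
  refine ⟨fun z ↦ T z - fun i ↦ ∫ y, T y i ∂μ, ?_, ?_, ?_⟩
  · exact (T.toHomeomorph.trans (Homeomorph.subRight _)).measurableEmbedding
  · refine map_eq_pi_gaussianReal T.toContinuousLinearMap _ fun i j ↦ ?_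
    rw [Real.coe_toNNReal _ (whitenedJointCov_eigenvalues_pos hμ i).le]
    exact hT i j
  · have : (fun i ↦ ∫ y, T y i ∂μ) = fun i ↦ ∫ y, T y i ∂(μ.fst.prod μ.snd) := by
      funext i
      exact (integral_dual_prod μ (component T i)).symm
    rw [this]
    exact map_eq_pi_gaussianReal T.toContinuousLinearMap (fun _ ↦ 1) fun i j ↦ by
      rw [NNReal.coe_one]; exact hT' i j

end PMIProfile

namespace PMIProfile

open Matrix

variable {m n : ℕ} {P : Measure (EuclideanSpace ℝ (Fin m) × EuclideanSpace ℝ (Fin n))}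

theorem sum_one_sub_eigenvalues_whitenedJointCov :
    ∑ i, (1 - (whitenedJointCov_isHermitian (μ := P)).eigenvalues i) = 0 :=
  sum_eigenvalues_fromBlocks_one _

theorem integral_llr_eq [IsGaussian P] (hP : P ≪ volume) :
    ∫ z, llr P (P.fst.prod P.snd) z ∂P =
      -(1 / 2) * Real.log (1 - (whitenedCov P)ᵀ * whitenedCov P).det := by
  obtain ⟨f, hf, h1, h2⟩ := exists_map_eq_pi hP
  have hpos := whitenedJointCov_eigenvalues_pos hP
  rw [integral_llr_of_map_eq_pi_gaussianReal hf
    (fun i ↦ (Real.toNNReal_pos.2 (hpos i)).ne') h1 h2]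
  simp_rw [Real.coe_toNNReal _ (hpos _).le]
  rw [Finset.sum_sub_distrib, ← Finset.mul_sum, ← Finset.mul_sum,
    sum_one_sub_eigenvalues_whitenedJointCov, mul_zero, sub_zero,
    ← Real.log_prod fun i _ ↦ (hpos i).ne']
  exact congrArg (fun x ↦ -(1 / 2) * Real.log x) (prod_eigenvalues_fromBlocks_one _)

theorem variance_llr_eq [IsGaussian P] (hP : P ≪ volume) :
    Var[llr P (P.fst.prod P.snd); P] = ((whitenedCov P)ᵀ * whitenedCov P).trace := by
  obtain ⟨f, hf, h1, h2⟩ := exists_map_eq_pi hP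
  have hpos := whitenedJointCov_eigenvalues_pos hP
  rw [variance_llr_of_map_eq_pi_gaussianReal hf
    (fun i ↦ (Real.toNNReal_pos.2 (hpos i)).ne') h1 h2]
  simp_rw [Real.coe_toNNReal _ (hpos _).le]
  rw [← Finset.mul_sum]
  have := sum_one_sub_eigenvalues_sq_fromBlocks_one (whitenedCov P)
  change (1 / 2) * ∑ i, (1 - (isHermitian_fromBlocks_one (whitenedCov P)).eigenvalues i) ^ 2 = _
  rw [this]
  ring

namespace IsNiceNormal

theorem absolutelyContinuous (h : IsNiceNormal P) : P ≪ volume := h.2.2.1.absolutelyContinuous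

theorem memLp_llr (h : IsNiceNormal P) : MemLp (llr P (P.fst.prod P.snd)) 2 P := by
  have := h.1
  obtain ⟨f, hf, h1, h2⟩ := exists_map_eq_pi h.absolutelyContinuous
  exact memLp_llr_of_map_eq_pi_gaussianReal hf (fun i ↦ (Real.toNNReal_pos.2
    (whitenedJointCov_eigenvalues_pos h.absolutelyContinuous i)).ne') h1 h2

theorem ac_prod (h : IsNiceNormal P) : P ≪ P.fst.prod P.snd := by
  have := h.1
  obtain ⟨f, hf, h1, h2⟩ := exists_map_eq_pi h.absolutelyContinuous
  exact ac_of_map_eq_pi_gaussianReal hf (fun i ↦ (Real.toNNReal_pos.2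
    (whitenedJointCov_eigenvalues_pos h.absolutelyContinuous i)).ne') h1 h2

theorem mutualInfo_ne_top (h : IsNiceNormal P) : mutualInfo P ≠ ⊤ := by
  have := h.1
  exact InformationTheory.klDiv_ne_top h.ac_prod (h.memLp_llr.integrable (by simp))

theorem toReal_mutualInfo (h : IsNiceNormal P) : (mutualInfo P).toReal =
    -(1 / 2) * Real.log (1 - (whitenedCov P)ᵀ * whitenedCov P).det := by
  have := h.1
  rw [mutualInfo, InformationTheory.toReal_klDiv_of_measure_eq h.ac_prod (by simp),
    integral_llr_eq h.absolutelyContinuous]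

theorem memLp_profile (h : IsNiceNormal P) : MemLp id 2 (profile P) := by
  rw [profile, memLp_map_measure_iff aestronglyMeasurable_id (measurable_pmi P).aemeasurable,
    Function.id_comp, memLp_congr_ae (pmi_ae_eq_llr h.2)]
  exact h.memLp_llr

theorem profileVariance_eq (h : IsNiceNormal P) :
    profileVariance P = ((whitenedCov P)ᵀ * whitenedCov P).trace := by
  have := h.1
  rw [profileVariance, profile, variance_map aemeasurable_id (measurable_pmi P).aemeasurable,
    Function.id_comp, variance_congr (pmi_ae_eq_llr h.2), variance_llr_eq h.absolutelyContinuous]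

theorem profileVariance_eq_sum (h : IsNiceNormal P) :
    profileVariance P = ∑ i, canonicalCorr P i ^ 2 := by
  rw [h.profileVariance_eq, ← sum_sq_singularValues]
  rfl

theorem sq_canonicalCorr_lt_one (h : IsNiceNormal P) (i : Fin (min m n)) :
    canonicalCorr P i ^ 2 < 1 := by
  have := h.1
  exact sq_singularValues_lt_one _ (whitenedJointCov_posDef h.absolutelyContinuous) i

theorem sum_log_eq (h : IsNiceNormal P) :
    ∑ i, Real.log (1 - canonicalCorr P i ^ 2) = -2 * (mutualInfo P).toReal := by
  rw [h.toReal_mutualInfo, ← prod_one_sub_sq_singularValues,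
    ← Real.log_prod fun i _ ↦ (sub_pos.2 (h.sq_canonicalCorr_lt_one i)).ne']
  simp only [canonicalCorr]
  ring

theorem profileVariance_le (h : IsNiceNormal P) (hk : 0 < min m n) :
    profileVariance P ≤ (min m n : ℕ) *
      (1 - Real.exp (-2 * (mutualInfo P).toReal / (min m n : ℕ))) := by
  rw [h.profileVariance_eq_sum, ← h.sum_log_eq]
  exact sum_le_of_sum_log hk h.sq_canonicalCorr_lt_one

theorem profileVariance_eq_iff (h : IsNiceNormal P) (hk : 0 < min m n) :
    profileVariance P = (min m n : ℕ) *
      (1 - Real.exp (-2 * (mutualInfo P).toReal / (min m n : ℕ))) ↔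
      ∀ i j, canonicalCorr P i ^ 2 = canonicalCorr P j ^ 2 := by
  rw [h.profileVariance_eq_sum, ← h.sum_log_eq]
  exact sum_eq_iff_of_sum_log hk h.sq_canonicalCorr_lt_one

end IsNiceNormal

/-- The rectangular matrix with all diagonal entries equal to `t`. -/
def rectDiagonal (m n : ℕ) (t : ℝ) : Matrix (Fin m) (Fin n) ℝ :=
  of fun i j ↦ if (i : ℕ) = j then t else 0

theorem rectDiagonal_transpose_mul_self (t : ℝ) :
    (rectDiagonal m n t)ᵀ * rectDiagonal m n t =
      diagonal fun j : Fin n ↦ if (j : ℕ) < m then t ^ 2 else 0 := by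
  ext j l
  simp only [mul_apply, transpose_apply, rectDiagonal, of_apply, diagonal_apply]
  by_cases hj : (j : ℕ) < m
  · rw [Finset.sum_eq_single (⟨j, hj⟩ : Fin m)]
    · by_cases hjl : j = l
      · simp [hjl, hjl ▸ hj, sq]
      · simp [hjl, Fin.val_inj]
    · intro i _ hi
      have : (i : ℕ) ≠ j := fun h ↦ hi (Fin.ext h)
      simp [this]
    · simp
  · rw [Finset.sum_eq_zero, if_neg hj, ite_self]
    intro i _
    have : (i : ℕ) ≠ j := fun h ↦ hj (h ▸ i.2)
    simp [this]

theorem trace_rectDiagonal (t : ℝ) :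
    ((rectDiagonal m n t)ᵀ * rectDiagonal m n t).trace = (min m n : ℕ) * t ^ 2 := by
  rw [rectDiagonal_transpose_mul_self, trace_diagonal]
  rw [← sum_fin_min_eq (m := m) (n := n) (fun i ↦ if i < m then t ^ 2 else 0)
    fun i hi hin ↦ if_neg (by omega)]
  rw [Finset.sum_congr rfl fun i _ ↦ if_pos (i.2.trans_le (min_le_left _ _))]
  simp

theorem det_rectDiagonal (t : ℝ) :
    (1 - (rectDiagonal m n t)ᵀ * rectDiagonal m n t).det = (1 - t ^ 2) ^ min m n := by
  rw [rectDiagonal_transpose_mul_self, ← diagonal_one, diagonal_sub, det_diagonal]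
  rw [← prod_fin_min_eq (m := m) (n := n) (fun i ↦ 1 - if i < m then t ^ 2 else 0)
    fun i hi hin ↦ by rw [if_neg (by omega), sub_zero]]
  rw [Finset.prod_congr rfl fun i _ ↦ by rw [if_pos (i.2.trans_le (min_le_left _ _))]]
  simp

theorem posDef_fromBlocks_rectDiagonal {t : ℝ} (ht : t ^ 2 < 1) :
    (fromBlocks 1 (rectDiagonal m n t) (rectDiagonal m n t)ᵀ 1).PosDef := by
  have hpsd : (fromBlocks 1 (rectDiagonal m n t) (rectDiagonal m n t)ᵀ 1).PosSemidef := by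
    let : Invertible (1 : Matrix (Fin m) (Fin m) ℝ) := invertibleOne
    have := (PosDef.one (n := Fin m) (R := ℝ)).fromBlocks₁₁ (rectDiagonal m n t) 1
    rw [conjTranspose_eq_transpose_of_trivial] at this
    rw [this, inv_one, Matrix.mul_one, rectDiagonal_transpose_mul_self, ← diagonal_one, diagonal_sub]
    refine PosSemidef.diagonal fun j ↦ ?_
    simp only [Pi.zero_apply]
    split_ifs <;> linarith
  rw [hpsd.posDef_iff_det_ne_zero, det_fromBlocks_one₁₁, det_rectDiagonal]
  exact pow_ne_zero _ (sub_pos.2 ht).ne'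

/-- The centred normal law with the given joint covariance matrix. -/
noncomputable def normalLaw (S : Matrix (Fin m ⊕ Fin n) (Fin m ⊕ Fin n) ℝ) :
    Measure (EuclideanSpace ℝ (Fin m) × EuclideanSpace ℝ (Fin n)) :=
  (multivariateGaussian 0 S).map ((EuclideanSpace.equiv (Fin m ⊕ Fin n) ℝ).trans
    (coord m n).toContinuousLinearEquiv.symm)

instance (S : Matrix (Fin m ⊕ Fin n) (Fin m ⊕ Fin n) ℝ) : IsGaussian (normalLaw S) :=
  isGaussian_map_equiv _

theorem jointCov_normalLaw {S : Matrix (Fin m ⊕ Fin n) (Fin m ⊕ Fin n) ℝ} (hS : S.PosSemidef) :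
    jointCov (normalLaw S) = S := by
  ext i j
  rw [← covariance_coord, normalLaw, covariance_map]
  · have h : ∀ k, (fun z ↦ coord m n z k) ∘ ((EuclideanSpace.equiv (Fin m ⊕ Fin n) ℝ).trans
        (coord m n).toContinuousLinearEquiv.symm) = fun x ↦ x k := fun k ↦ by
      funext x
      exact congrFun ((coord m n).apply_symm_apply x.ofLp) k
    rw [h, h]
    exact covariance_eval_multivariateGaussian hS i j
  · exact (component (coord m n).toContinuousLinearEquiv i).continuous.aestronglyMeasurable
  · exact (component (coord m n).toContinuousLinearEquiv j).continuous.aestronglyMeasurable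
  · fun_prop

theorem hasSmoothPosDensity_of_jointCov [IsGaussian P] (h : (jointCov P).PosDef) :
    HasSmoothPosDensity P := by
  set U : Matrix (Fin m ⊕ Fin n) (Fin m ⊕ Fin n) ℝ := h.isHermitian.eigenvectorUnitary.1
  have hU : Uᵀ * U = 1 := Unitary.coe_star_mul_self h.isHermitian.eigenvectorUnitary
  refine hasSmoothPosDensity_of_covariance (coordEquiv hU)
    (v := fun i ↦ (h.isHermitian.eigenvalues i).toNNReal)
    (fun i ↦ (Real.toNNReal_pos.2 (h.eigenvalues_pos i)).ne') fun i j ↦ ?_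
  rw [covariance_coordEquiv, transpose_transpose, h.isHermitian.star_eigenvectorUnitary_mul,
    diagonal_apply, Real.coe_toNNReal _ (h.eigenvalues_pos i).le]

theorem hasSmoothPosDensity_of_covariance_one {d : ℕ} {μ : Measure (EuclideanSpace ℝ (Fin d))}
    [IsGaussian μ] (h : (of fun i j : Fin d ↦ cov[fun x ↦ x i, fun x ↦ x j; μ]) = 1) :
    HasSmoothPosDensity μ := by
  refine hasSmoothPosDensity_of_covariance (EuclideanSpace.equiv (Fin d) ℝ) (v := fun _ ↦ 1)
    (fun _ ↦ one_ne_zero) fun i j ↦ ?_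
  have := congrFun (congrFun h i) j
  rw [one_apply] at this
  rw [NNReal.coe_one]
  exact this

theorem exists_isNiceNormal (hk : 0 < min m n) (I : ℝ≥0) :
    ∃ P : Measure (EuclideanSpace ℝ (Fin m) × EuclideanSpace ℝ (Fin n)),
      IsNiceNormal P ∧ mutualInfo P = I ∧
      profileVariance P = (min m n : ℕ) * (1 - Real.exp (-2 * (I : ℝ) / (min m n : ℕ))) := by
  have hk' : (0 : ℝ) < (min m n : ℕ) := by exact_mod_cast hk
  set a := 1 - Real.exp (-2 * (I : ℝ) / (min m n : ℕ)) with ha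
  have ha0 : 0 ≤ a := by
    rw [ha, sub_nonneg, Real.exp_le_one_iff]
    exact div_nonpos_of_nonpos_of_nonneg (by have := I.2; simp) hk'.le
  have ht : Real.sqrt a ^ 2 = a := Real.sq_sqrt ha0
  have ht1 : Real.sqrt a ^ 2 < 1 := by
    rw [ht, ha]; linarith [Real.exp_pos (-2 * (I : ℝ) / (min m n : ℕ))]
  set C := rectDiagonal m n (Real.sqrt a) with hC
  have hS := posDef_fromBlocks_rectDiagonal (m := m) (n := n) ht1
  set P := normalLaw (fromBlocks 1 C Cᵀ 1) with hPdef
  have hcov : jointCov P = fromBlocks 1 C Cᵀ 1 := jointCov_normalLaw hS.posSemidef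
  obtain ⟨hX, hXY, -, hY⟩ := fromBlocks_inj.1 hcov
  have hP : IsNiceNormal P := by
    refine ⟨inferInstance, inferInstance, ?_, ?_, ?_⟩
    · exact hasSmoothPosDensity_of_jointCov (hcov ▸ hS)
    · exact hasSmoothPosDensity_of_covariance_one ((covX_eq_fst P).symm.trans hX)
    · exact hasSmoothPosDensity_of_covariance_one ((covY_eq_snd P).symm.trans hY)
  have hW : whitenedCov P = C := by
    rw [whitenedCov, hX, hXY, hY]
    simp
  refine ⟨P, hP, ?_, ?_⟩
  · rw [← ENNReal.coe_toNNReal hP.mutualInfo_ne_top, ENNReal.coe_inj, ← NNReal.coe_inj]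
    change (mutualInfo P).toReal = _
    rw [hP.toReal_mutualInfo, hW, det_rectDiagonal, ht, Real.log_pow, ha, sub_sub_cancel,
      Real.log_exp]
    field_simp
  · rw [hP.profileVariance_eq, hW, trace_rectDiagonal, ht]

end PMIProfile

theorem mainTheorem8 (m n : ℕ) (hm : 0 < m) (hn : 0 < n) :
    -- mutual information is finite and the profile has a finite second moment
    (∀ P : Measure (EuclideanSpace ℝ (Fin m) × EuclideanSpace ℝ (Fin n)),
      PMIProfile.IsNiceNormal P →
        PMIProfile.mutualInfo P ≠ ⊤ ∧ MemLp id 2 (PMIProfile.profile P)) ∧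
    -- the bound
    (∀ P : Measure (EuclideanSpace ℝ (Fin m) × EuclideanSpace ℝ (Fin n)),
      PMIProfile.IsNiceNormal P →
        PMIProfile.profileVariance P ≤ (min m n : ℕ) *
          (1 - Real.exp (-2 * (PMIProfile.mutualInfo P).toReal / (min m n : ℕ)))) ∧
    -- for fixed mutual information, the maximizers are the laws with all `ρᵢ²` equal
    (∀ I : ℝ≥0, ∀ P : Measure (EuclideanSpace ℝ (Fin m) × EuclideanSpace ℝ (Fin n)),
      PMIProfile.IsNiceNormal P → PMIProfile.mutualInfo P = I →
        (IsMaxOn PMIProfile.profileVariance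
            {P' | PMIProfile.IsNiceNormal P' ∧ PMIProfile.mutualInfo P' = I} P ↔
          ∀ i j, PMIProfile.canonicalCorr P i ^ 2 = PMIProfile.canonicalCorr P j ^ 2)) ∧
    -- the bound is the maximum for every value of the mutual information
    (∀ I : ℝ≥0, IsGreatest
      (PMIProfile.profileVariance ''
        {P : Measure (EuclideanSpace ℝ (Fin m) × EuclideanSpace ℝ (Fin n)) |
          PMIProfile.IsNiceNormal P ∧ PMIProfile.mutualInfo P = I})
      ((min m n : ℕ) * (1 - Real.exp (-2 * (I : ℝ) / (min m n : ℕ))))) := by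
  have hk : 0 < min m n := lt_min hm hn
  have hle : ∀ (I : ℝ≥0) (P : Measure (EuclideanSpace ℝ (Fin m) × EuclideanSpace ℝ (Fin n))),
      PMIProfile.IsNiceNormal P → PMIProfile.mutualInfo P = I →
      PMIProfile.profileVariance P ≤
        (min m n : ℕ) * (1 - Real.exp (-2 * (I : ℝ) / (min m n : ℕ))) := fun I P hP hI ↦ by
    have := hP.profileVariance_le hk
    rwa [hI, ENNReal.coe_toReal] at this
  refine ⟨fun P hP ↦ ⟨hP.mutualInfo_ne_top, hP.memLp_profile⟩,
    fun P hP ↦ hP.profileVariance_le hk, fun I P hP hI ↦ ?_, fun I ↦ ⟨?_, ?_⟩⟩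
  · have hiff := hP.profileVariance_eq_iff hk
    rw [hI, ENNReal.coe_toReal] at hiff
    rw [← hiff, isMaxOn_iff]
    constructor
    · intro h
      obtain ⟨Q, hQ, hQI, hQV⟩ := PMIProfile.exists_isNiceNormal hk I
      exact (hle I P hP hI).antisymm (hQV ▸ h Q ⟨hQ, hQI⟩)
    · rintro h Q ⟨hQ, hQI⟩
      exact (hle I Q hQ hQI).trans_eq h.symm
  · obtain ⟨Q, hQ, hQI, hQV⟩ := PMIProfile.exists_isNiceNormal hk I
    exact ⟨Q, ⟨hQ, hQI⟩, hQV⟩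
  · rintro _ ⟨Q, ⟨hQ, hQI⟩, rfl⟩
    exact hle I Q hQ hQI
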